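/- Let $q$ be a prime power and $n$ a positive integer. For subspaces $U,V$ of $\mathrm{GF}(q)^n$ let $d_S(U,V)=\dim(U+V)-\dim(U\cap V)$ be the subspace distance and $d_I(U,V)=\tfrac12 d_S(U,V)+\tfrac12|\dim U-\dim V|$ the injection distance. Let $A_S(q,n,d)$ (respectively $A_I(q,n,d)$) be the maximum cardinality of a nonempty set of subspaces of $\mathrm{GF}(q)^n$ (of arbitrary dimensions) in which any two distinct members are at subspace (respectively injection) distance at least $d$. Put $K_q=\prod_{j=1}^\infty(1-q^{-j})$ and $\theta(q)=\sum_{m=0}^\infty q^{-m^2}$. Then for every integer $d$ with $2\le d\le\lfloor n/2\rfloor$, $$A_S(q,n,2d)\le A_S(q,n,2d-1)\le A_I(q,n,d)<2K_q^{-1}\theta(q)\,A_S(q,n,2d),$$ and moreover $$A_I(q,n,d)<2K_q^{-2}\theta(q)\,q^{(n-\lfloor n/2\rfloor)(\lfloor n/2\rfloor-d+1)}.$$ -/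

import Mathlib

open scoped BigOperators

noncomputable section

namespace SubspaceCodes

/-- The projective space `E(q,n)`, that is, the set of all linear subspaces of `F^n`, where
`F` is the finite field with `q` elements. -/
abbrev ProjSpace (F : Type*) [Field F] (n : ℕ) : Type _ := Submodule F (Fin n → F)

/-- The dimension of a subspace, as a real number. -/
def dimR {F : Type*} [Field F] {n : ℕ} (U : ProjSpace F n) : ℝ := (Module.finrank F U : ℝ)

/-- The subspace metric `d_S(U,V) = dim (U + V) - dim (U ∩ V)`. -/
def subspaceDist {F : Type*} [Field F] {n : ℕ} (U V : ProjSpace F n) : ℝ :=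
  dimR (U ⊔ V) - dimR (U ⊓ V)

/-- The injection metric `d_I(U,V) = d_S(U,V) / 2 + |dim U - dim V| / 2`. -/
def injectionDist {F : Type*} [Field F] {n : ℕ} (U V : ProjSpace F n) : ℝ :=
  1 / 2 * subspaceDist U V + 1 / 2 * |dimR U - dimR V|

/-- `C` is a subspace code (a nonempty set of subspaces) whose minimum distance with respect to
`dist`, over all pairs of distinct codewords, is at least `d`. -/
def IsCode {F : Type*} [Field F] {n : ℕ} (dist : ProjSpace F n → ProjSpace F n → ℝ) (d : ℕ)
    (C : Set (ProjSpace F n)) : Prop :=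
  C.Nonempty ∧ ∀ U ∈ C, ∀ V ∈ C, U ≠ V → (d : ℝ) ≤ dist U V

/-- The maximum cardinality of a subspace code with minimum distance `d` with respect to `dist`. -/
def maxCard {F : Type*} [Field F] {n : ℕ} (dist : ProjSpace F n → ProjSpace F n → ℝ) (d : ℕ) : ℕ :=
  sSup {m : ℕ | ∃ C : Set (ProjSpace F n), IsCode dist d C ∧ C.ncard = m}

/-- Over a finite field the maximum in `maxCard` exists. -/
theorem maxCard_isGreatest {F : Type*} [Field F] [Fintype F] {n : ℕ}
    (dist : ProjSpace F n → ProjSpace F n → ℝ) (d : ℕ) :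
    IsGreatest {m : ℕ | ∃ C : Set (ProjSpace F n), IsCode dist d C ∧ C.ncard = m}
      (maxCard dist d) := by
  have hfin : Finite (ProjSpace F n) := inferInstance
  have hne : {m : ℕ | ∃ C : Set (ProjSpace F n), IsCode dist d C ∧ C.ncard = m}.Nonempty := by
    refine ⟨_, {⊥}, ⟨Set.singleton_nonempty _, ?_⟩, rfl⟩
    intro U hU V hV hUV
    exact absurd (hU.trans hV.symm) hUV
  have hbdd : BddAbove {m : ℕ | ∃ C : Set (ProjSpace F n), IsCode dist d C ∧ C.ncard = m} := by
    refine ⟨Nat.card (ProjSpace F n), ?_⟩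
    rintro m ⟨C, -, rfl⟩
    exact Set.ncard_le_card C
  exact ⟨Nat.sSup_mem hne hbdd, fun m hm => le_csSup hbdd hm⟩

/-- `A_S(q,n,d)`, for the subspace metric on the subspaces of `F^n`, with `F` of order `q`. -/
def AS (F : Type*) [Field F] (n d : ℕ) : ℕ :=
  maxCard (F := F) (n := n) subspaceDist d

/-- `A_I(q,n,d)`, for the injection metric on the subspaces of `F^n`, with `F` of order `q`. -/
def AI (F : Type*) [Field F] (n d : ℕ) : ℕ :=
  maxCard (F := F) (n := n) injectionDist d

/-- `K_q = ∏_{j ≥ 1} (1 - q^{-j})`. -/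
def Kq (q : ℕ) : ℝ := ∏' j : ℕ, (1 - ((q : ℝ) ^ (j + 1))⁻¹)

/-- `θ(q) = ∑_{n ≥ 0} q^{-n^2}`. -/
def theta (q : ℕ) : ℝ := ∑' n : ℕ, ((q : ℝ) ^ (n ^ 2))⁻¹

/-- The infinite product defining `K_q` converges. -/
theorem multipliable_Kq {q : ℕ} (hq : 2 ≤ q) :
    Multipliable fun j : ℕ => 1 - ((q : ℝ) ^ (j + 1))⁻¹ := by
  have hq' : (1 : ℝ) < q := by exact_mod_cast hq
  have hs : Summable fun j : ℕ => ((q : ℝ)⁻¹) ^ (j + 1) :=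
    (summable_nat_add_iff 1).2
      (summable_geometric_of_lt_one (by positivity) (inv_lt_one_of_one_lt₀ hq'))
  have h := Real.multipliable_one_add_of_summable hs.neg
  simpa [sub_eq_add_neg] using h

/-- The series defining `θ(q)` converges. -/
theorem summable_theta {q : ℕ} (hq : 2 ≤ q) :
    Summable fun n : ℕ => ((q : ℝ) ^ (n ^ 2))⁻¹ := by
  have hq' : (1 : ℝ) < q := by exact_mod_cast hq
  refine Summable.of_nonneg_of_le (fun n => by positivity) (fun n => ?_)
    (summable_geometric_of_lt_one (by positivity) (inv_lt_one_of_one_lt₀ hq'))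
  rw [inv_pow]
  exact inv_anti₀ (by positivity) (pow_le_pow_right₀ hq'.le (Nat.le_self_pow two_ne_zero n))

end SubspaceCodes

end

namespace SubspaceCodes

open Module

/-! With ν = ⌊n/2⌋ and M = ν - d + 1, both sides are compared with q^((n-ν)M). Upper bound
(`AI_lt`): codewords of one dimension r meet in dimension less than k = r - d + 1, so a linearly
independent k-tuple lies in at most one of them; counting tuples gives at most K_q⁻¹ q^((n-r)k)
codewords. For r = ν - m the exponent is at most (n-ν)M - m², so summing over m produces θ(q).
Annihilators carry the dimensions above ν to those below, whence the factor 2. Lower bound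
(`pow_le_AS`): graphs of the maps in a Gabidulin code form a code of size exactly q^((n-ν)M) with
subspace distance at least 2d. -/

/-! ### The product K_q and its finite subproducts. -/

theorem Kq_factor_pos {q : ℕ} (hq : 2 ≤ q) (j : ℕ) : 0 < 1 - ((q : ℝ) ^ (j + 1))⁻¹ := by
  have hq' : (1 : ℝ) < q := by exact_mod_cast hq
  exact sub_pos.2 (inv_lt_one_of_one_lt₀ (one_lt_pow₀ hq' j.succ_ne_zero))

theorem Kq_factor_le_one (q j : ℕ) : 1 - ((q : ℝ) ^ (j + 1))⁻¹ ≤ 1 :=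
  sub_le_self _ (by positivity)

theorem Kq_pos {q : ℕ} (hq : 2 ≤ q) : 0 < Kq q := by
  have hq' : (1 : ℝ) < q := by exact_mod_cast hq
  have hs : Summable fun j : ℕ => ((q : ℝ)⁻¹) ^ (j + 1) :=
    (summable_nat_add_iff 1).2
      (summable_geometric_of_lt_one (by positivity) (inv_lt_one_of_one_lt₀ hq'))
  have hl := Real.summable_log_one_add_of_summable hs.neg
  have hl' : Summable fun j : ℕ => Real.log (1 - ((q : ℝ) ^ (j + 1))⁻¹) := by
    simpa [sub_eq_add_neg] using hl
  rw [Kq, ← Real.rexp_tsum_eq_tprod (Kq_factor_pos hq) hl']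
  exact Real.exp_pos _

theorem Kq_le_prod {q : ℕ} (hq : 2 ≤ q) (s : Finset ℕ) :
    Kq q ≤ ∏ j ∈ s, (1 - ((q : ℝ) ^ (j + 1))⁻¹) := by
  obtain ⟨N, hN⟩ := s.exists_nat_subset_range
  refine le_of_tendsto (multipliable_Kq hq).hasProd.tendsto_prod_nat ?_
  filter_upwards [Filter.eventually_ge_atTop N] with t ht
  exact Finset.prod_le_prod_of_subset_of_le_one
    (hN.trans (Finset.range_subset_range.2 ht)) (fun i _ => (Kq_factor_pos hq i).le)
    fun i _ _ => Kq_factor_le_one q i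

theorem Kq_le_one {q : ℕ} (hq : 2 ≤ q) : Kq q ≤ 1 := by
  simpa using Kq_le_prod hq ∅

/-- Each factor is q^r (1 - q^(-(r-i))), and the exponents r - i are distinct and positive, so the
product over i is q^(rk) times a finite subproduct of K_q. -/
theorem Kq_mul_pow_le_prod {q : ℕ} (hq : 2 ≤ q) {k r : ℕ} (hk : k ≤ r) :
    Kq q * (q : ℝ) ^ (r * k) ≤ ((∏ i : Fin k, (q ^ r - q ^ i.val) : ℕ) : ℝ) := by
  have hq0 : (q : ℝ) ≠ 0 := by positivity
  rw [Fin.prod_univ_eq_prod_range (fun i => q ^ r - q ^ i) k, Nat.cast_prod]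
  have hfac : ∀ i ∈ Finset.range k,
      ((q ^ r - q ^ i : ℕ) : ℝ) = (1 - ((q : ℝ) ^ ((r - 1 - i) + 1))⁻¹) * (q : ℝ) ^ r := by
    intro i hi
    have hi' : i < r := (Finset.mem_range.1 hi).trans_le hk
    rw [Nat.cast_sub (Nat.pow_le_pow_right (by omega) hi'.le)]
    have : (q : ℝ) ^ r = (q : ℝ) ^ ((r - 1 - i) + 1) * (q : ℝ) ^ i := by
      rw [← pow_add]; congr 1; omega
    push_cast
    rw [sub_mul, one_mul]
    congr 1
    rw [this, inv_mul_cancel_left₀ (pow_ne_zero _ hq0)]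
  rw [Finset.prod_congr rfl hfac, Finset.prod_mul_distrib, Finset.prod_const, Finset.card_range,
    pow_mul]
  gcongr
  have hinj : Set.InjOn (fun i => r - 1 - i) (Finset.range k : Set ℕ) := by
    intro a ha b hb h
    simp only [Finset.coe_range, Set.mem_Iio] at ha hb h
    omega
  rw [← Finset.prod_image (f := fun j => 1 - ((q : ℝ) ^ (j + 1))⁻¹) hinj]
  exact Kq_le_prod hq _

variable {F : Type*} [Field F]

/-! ### Upper bounds by counting independent tuples. -/

section Bounds

variable {V : Type*} [AddCommGroup V] [Module F V] [FiniteDimensional F V] [Fintype F]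

/-- Counting linearly independent `k`-tuples bounds a family of `r`-dimensional subspaces which
pairwise meet in dimension less than `k`. -/
theorem card_mul_prod_le (S : Finset (Submodule F V)) {r k : ℕ} (hk : k ≤ r)
    (hr : ∀ U ∈ S, finrank F U = r)
    (hS : ∀ U ∈ S, ∀ W ∈ S, U ≠ W → finrank F ↥(U ⊓ W) < k) :
    S.card * ∏ i : Fin k, (Fintype.card F ^ r - Fintype.card F ^ i.val) ≤
      Fintype.card F ^ (finrank F V * k) := by
  have : Finite V := Module.finite_of_finite F
  let f : (Σ U : S, {s : Fin k → U.1 // LinearIndependent F s}) → (Fin k → V) :=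
    fun x i => (x.2.1 i : V)
  have hf : Function.Injective f := by
    rintro ⟨⟨U, hU⟩, s, hs⟩ ⟨⟨W, hW⟩, t, ht⟩ h
    have hst : ∀ i, (s i : V) = t i := fun i => congrFun h i
    -- A tuple lying in both subspaces would be k independent vectors in U ⊓ W.
    have hUW : U = W := by
      by_contra hne
      let u : Fin k → ↥(U ⊓ W) := fun i => ⟨s i, (s i).2, hst i ▸ (t i).2⟩
      have hu : LinearIndependent F u := by
        refine LinearIndependent.of_comp (U ⊓ W).subtype ?_
        exact hs.map' U.subtype (Submodule.ker_subtype U)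
      have := hu.fintype_card_le_finrank
      rw [Fintype.card_fin] at this
      exact absurd (hS U hU W hW hne) this.not_gt
    subst hUW
    have : s = t := funext fun i => Subtype.ext (hst i)
    subst this
    rfl
  have h := Nat.card_le_card_of_injective f hf
  have hc : ∀ U : S, Nat.card {s : Fin k → U.1 // LinearIndependent F s} =
      ∏ i : Fin k, (Fintype.card F ^ r - Fintype.card F ^ i.val) := by
    intro U
    rw [card_linearIndependent (hk.trans_eq (hr U.1 U.2).symm), hr U.1 U.2]
  rw [Nat.card_sigma, Finset.sum_congr rfl fun U _ => hc U, Finset.sum_const, Finset.card_univ,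
    Fintype.card_coe, smul_eq_mul] at h
  refine h.trans_eq ?_
  rw [Nat.card_fun, Module.natCard_eq_pow_finrank (K := F), Nat.card_eq_fintype_card,
    Nat.card_eq_fintype_card, Fintype.card_fin, ← pow_mul]

theorem card_le_of_finrank_inf_lt (S : Finset (Submodule F V)) {r k : ℕ} (hk : k ≤ r)
    (hr : ∀ U ∈ S, finrank F U = r)
    (hS : ∀ U ∈ S, ∀ W ∈ S, U ≠ W → finrank F ↥(U ⊓ W) < k) (hrn : r ≤ finrank F V) :
    (S.card : ℝ) ≤ (Kq (Fintype.card F))⁻¹ * (Fintype.card F : ℝ) ^ ((finrank F V - r) * k) := by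
  have hq : 2 ≤ Fintype.card F := Fintype.one_lt_card
  have h : ((S.card * ∏ i : Fin k, (Fintype.card F ^ r - Fintype.card F ^ i.val) : ℕ) : ℝ) ≤
      ((Fintype.card F ^ (finrank F V * k) : ℕ) : ℝ) := by
    exact_mod_cast card_mul_prod_le S hk hr hS
  rw [Nat.cast_mul, Nat.cast_pow] at h
  have hK := Kq_pos hq
  have h2 := (mul_le_mul_of_nonneg_left (Kq_mul_pow_le_prod hq hk) (Nat.cast_nonneg S.card)).trans h
  have hexp : finrank F V * k = (finrank F V - r) * k + r * k := by
    rw [← add_mul, Nat.sub_add_cancel hrn]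
  rw [hexp, pow_add, ← mul_assoc] at h2
  have h3 := le_of_mul_le_mul_right h2 (by positivity)
  rw [inv_mul_eq_div, le_div_iff₀ hK]
  exact h3

/-- Subspaces of dimension at most half of the dimension of the whole space, pairwise at injection
distance at least `d`. -/
theorem card_lt_of_finrank_le (C : Finset (Submodule F V)) {ν d : ℕ} (hd : 1 ≤ d) (hdν : d ≤ ν)
    (hν : 2 * ν ≤ finrank F V) (hC : ∀ U ∈ C, finrank F U ≤ ν)
    (hdist : ∀ U ∈ C, ∀ W ∈ C, U ≠ W →
      d + finrank F ↥(U ⊓ W) ≤ max (finrank F U) (finrank F W)) :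
    (C.card : ℝ) < (Kq (Fintype.card F))⁻¹ * theta (Fintype.card F) *
      (Fintype.card F : ℝ) ^ ((finrank F V - ν) * (ν - d + 1)) := by
  classical
  set q := Fintype.card F with hqdef
  have hq : 2 ≤ q := Fintype.one_lt_card
  have hq1 : (1 : ℝ) ≤ q := by exact_mod_cast (by omega : 1 ≤ q)
  have hK := Kq_pos hq
  set M := ν - d + 1 with hM
  -- The level is the codimension below ν, capped at M so that all dimensions less than d share the
  -- last level.
  let level : Submodule F V → ℕ := fun U => min (ν - finrank F U) M
  have hfib : ∀ m ∈ Finset.range (M + 1), ((C.filter fun U => level U = m).card : ℝ) ≤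
      (Kq q)⁻¹ * ((q : ℝ) ^ ((finrank F V - ν) * M) * ((q : ℝ) ^ (m ^ 2))⁻¹) := by
    intro m hm
    have hmM : m ≤ M := Nat.lt_succ_iff.1 (Finset.mem_range.1 hm)
    -- With N = dim V, the difference of the two sides is m(N - ν - M), and M ≤ ν ≤ N - ν.
    have hexp : (finrank F V - (ν - m)) * (M - m) + m ^ 2 ≤ (finrank F V - ν) * M := by
      obtain ⟨k, hk⟩ := Nat.exists_eq_add_of_le hmM
      obtain ⟨s, hs⟩ := Nat.exists_eq_add_of_le hν
      have h1 : finrank F V - (ν - m) = ν + s + m := by omega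
      have h2 : finrank F V - ν = ν + s := by omega
      have h3 : M - m = k := by omega
      have h4 : m + k ≤ ν + s := by omega
      rw [h1, h2, h3, hk]
      nlinarith [Nat.mul_le_mul_left m h4]
    have hpow : (q : ℝ) ^ ((finrank F V - (ν - m)) * (M - m)) ≤
        (q : ℝ) ^ ((finrank F V - ν) * M) * ((q : ℝ) ^ (m ^ 2))⁻¹ := by
      rw [← div_eq_mul_inv, le_div_iff₀ (by positivity), ← pow_add]
      exact pow_le_pow_right₀ hq1 hexp
    refine le_trans ?_ (mul_le_mul_of_nonneg_left hpow (inv_nonneg.2 hK.le))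
    rcases hmM.lt_or_eq with hlt | rfl
    · have hr : ∀ U ∈ C.filter (fun U => level U = m), finrank F U = ν - m := by
        intro U hU
        obtain ⟨hU, hl⟩ := Finset.mem_filter.1 hU
        have := hC U hU
        simp only [level] at hl
        omega
      refine card_le_of_finrank_inf_lt _ (by omega) hr (fun U hU W hW hne => ?_) (by omega)
      have := hdist U (Finset.mem_filter.1 hU).1 W (Finset.mem_filter.1 hW).1 hne
      rw [hr U hU, hr W hW, max_self] at this
      omega
    -- Two distinct codewords of dimension below d cannot be at injection distance d.
    · have hc : (C.filter fun U => level U = M).card ≤ 1 := by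
        rw [Finset.card_le_one]
        intro U hU W hW
        obtain ⟨hU, hlU⟩ := Finset.mem_filter.1 hU
        obtain ⟨hW, hlW⟩ := Finset.mem_filter.1 hW
        by_contra hne
        have := hdist U hU W hW hne
        simp only [level] at hlU hlW
        omega
      rw [Nat.sub_self, mul_zero, pow_zero, mul_one]
      calc ((C.filter fun U => level U = M).card : ℝ) ≤ 1 := by exact_mod_cast hc
        _ ≤ (Kq q)⁻¹ := (one_le_inv₀ hK).2 (Kq_le_one hq)
  have hsum : C.card = ∑ m ∈ Finset.range (M + 1), (C.filter fun U => level U = m).card :=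
    Finset.card_eq_sum_card_fiberwise fun U _ =>
      Finset.mem_coe.2 (Finset.mem_range.2 (Nat.lt_succ_iff.2 (min_le_right _ _)))
  have htheta : ∑ m ∈ Finset.range (M + 1), ((q : ℝ) ^ (m ^ 2))⁻¹ < theta q := by
    -- One further positive term makes the inequality strict.
    refine lt_of_lt_of_le ?_ ((summable_theta hq).sum_le_tsum (Finset.range (M + 2))
      fun _ _ => by positivity)
    rw [Finset.sum_range_succ _ (M + 1)]
    exact lt_add_of_pos_right _ (by positivity)
  rw [hsum, Nat.cast_sum]
  refine (Finset.sum_le_sum hfib).trans_lt ?_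
  rw [← Finset.mul_sum, ← Finset.mul_sum, mul_assoc, mul_comm (theta q)]
  gcongr

/-- The version of `card_lt_of_finrank_le` for subspaces of large dimension, obtained by passing
to annihilators. -/
theorem card_lt_of_le_finrank (C : Finset (Submodule F V)) {ν d : ℕ} (hd : 1 ≤ d) (hdν : d ≤ ν)
    (hν : 2 * ν ≤ finrank F V) (hC : ∀ U ∈ C, finrank F V - ν ≤ finrank F U)
    (hdist : ∀ U ∈ C, ∀ W ∈ C, U ≠ W →
      d + finrank F ↥(U ⊓ W) ≤ max (finrank F U) (finrank F W)) :
    (C.card : ℝ) < (Kq (Fintype.card F))⁻¹ * theta (Fintype.card F) *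
      (Fintype.card F : ℝ) ^ ((finrank F V - ν) * (ν - d + 1)) := by
  classical
  have hinj : Function.Injective
      (Submodule.dualAnnihilator : Submodule F V → Submodule F (Dual F V)) :=
    fun U W h => Subspace.dualAnnihilator_inj.1 h
  have hfr : finrank F (Dual F V) = finrank F V := Subspace.dual_finrank_eq
  have key := card_lt_of_finrank_le (C.image Submodule.dualAnnihilator) hd hdν
    (hν.trans_eq hfr.symm) ?_ ?_
  · rwa [Finset.card_image_of_injective _ hinj, hfr] at key
  · simp only [Finset.forall_mem_image]
    intro U hU
    have := Subspace.finrank_add_finrank_dualAnnihilator_eq U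
    have := hC U hU
    omega
  · simp only [Finset.forall_mem_image]
    intro U hU W hW hne
    have h := hdist U hU W hW fun h => hne (congrArg _ h)
    -- The injection distance is also dim (U + W) - min (dim U) (dim W), so it is invariant under
    -- annihilators.
    rw [← Submodule.dualAnnihilator_sup_eq]
    have := Subspace.finrank_add_finrank_dualAnnihilator_eq U
    have := Subspace.finrank_add_finrank_dualAnnihilator_eq W
    have := Subspace.finrank_add_finrank_dualAnnihilator_eq (U ⊔ W)
    have := Submodule.finrank_sup_add_finrank_inf_eq U W
    omega

end Bounds

/-! ### Gabidulin codes and their lifting by graphs. -/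

section RankMetric

variable [Fintype F] {L W : Type*} [Field L] [Algebra F L] [AddCommGroup W] [Module F W]

/-- The map `w ↦ ∑ aᵢ ι(w)^(q^i)`, a codeword of a Gabidulin code. -/
noncomputable def gabidulinMap (ι : W →ₗ[F] L) {k : ℕ} (a : Fin k → L) : W →ₗ[F] L :=
  ∑ i : Fin k, LinearMap.mulLeft F (a i) ∘ₗ
    (FiniteField.frobeniusAlgHom F L ^ i.val).toLinearMap ∘ₗ ι

theorem gabidulinMap_apply (ι : W →ₗ[F] L) {k : ℕ} (a : Fin k → L) (w : W) :
    gabidulinMap ι a w = ∑ i : Fin k, a i * ι w ^ (Fintype.card F ^ i.val) := by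
  simp [gabidulinMap, AlgHom.coe_pow, FiniteField.coe_frobeniusAlgHom, pow_iterate]

theorem gabidulinMap_sub (ι : W →ₗ[F] L) {k : ℕ} (a b : Fin k → L) :
    gabidulinMap ι a - gabidulinMap ι b = gabidulinMap ι (a - b) := by
  ext w
  simp [gabidulinMap_apply, sub_mul, Finset.sum_sub_distrib]

open Polynomial in
-- The kernel embeds into the roots of a nonzero polynomial of degree at most q^(k-1), so it has at
-- most q^(k-1) elements.
theorem finrank_ker_gabidulinMap_lt [FiniteDimensional F W] {ι : W →ₗ[F] L}
    (hι : Function.Injective ι) {k : ℕ} {a : Fin k → L} (ha : a ≠ 0) :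
    finrank F (LinearMap.ker (gabidulinMap ι a)) < k := by
  classical
  have hq : 1 < Fintype.card F := Fintype.one_lt_card
  obtain ⟨i₀, hi₀⟩ := Function.ne_iff.1 ha
  let P : L[X] := ∑ i : Fin k, C (a i) * X ^ (Fintype.card F ^ i.val)
  have hcoeff : P.coeff (Fintype.card F ^ i₀.val) = a i₀ := by
    simp only [P, finsetSum_coeff, coeff_C_mul_X_pow, Nat.pow_right_inj hq, Fin.val_inj]
    simp
  have hP : P ≠ 0 := fun h => hi₀ (by rw [← hcoeff, h, coeff_zero]; rfl)
  have hdeg : P.natDegree ≤ Fintype.card F ^ (k - 1) := by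
    refine natDegree_sum_le_of_forall_le _ _ fun i _ => (natDegree_C_mul_X_pow_le _ _).trans ?_
    exact Nat.pow_le_pow_right hq.le (by omega)
  have hroot : ∀ w : LinearMap.ker (gabidulinMap ι a), ι w.1 ∈ P.roots.toFinset := by
    intro w
    have hw : gabidulinMap ι a w.1 = 0 := w.2
    rw [Multiset.mem_toFinset, mem_roots hP, IsRoot.def, ← hw, gabidulinMap_apply]
    simp [P, eval_finsetSum]
  have hcard := Nat.card_le_card_of_injective
    (fun w : LinearMap.ker (gabidulinMap ι a) => (⟨ι w.1, hroot w⟩ : P.roots.toFinset))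
    fun v w h => Subtype.ext (hι (Subtype.ext_iff.1 h))
  rw [Module.natCard_eq_pow_finrank (K := F), Nat.card_eq_fintype_card, Nat.card_eq_fintype_card,
    Fintype.card_coe] at hcard
  have h := hcard.trans ((Multiset.toFinset_card_le _).trans ((card_roots' P).trans hdeg))
  have := (Nat.pow_le_pow_iff_right hq).1 h
  have := i₀.pos
  omega

end RankMetric

theorem finrank_graph {V W : Type*} [AddCommGroup V] [Module F V] [AddCommGroup W] [Module F W]
    (f : V →ₗ[F] W) : finrank F f.graph = finrank F V := by
  rw [LinearMap.graph_eq_range_prod]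
  exact LinearMap.finrank_range_of_inj fun x y h => congrArg Prod.fst h

theorem finrank_graph_inf_graph_le {V W : Type*} [AddCommGroup V] [Module F V]
    [FiniteDimensional F V] [AddCommGroup W] [Module F W] (f g : V →ₗ[F] W) :
    finrank F ↥(f.graph ⊓ g.graph) ≤ finrank F (LinearMap.ker (f - g)) := by
  let p : ↥(f.graph ⊓ g.graph) →ₗ[F] LinearMap.ker (f - g) :=
    LinearMap.codRestrict _ (LinearMap.fst F V W ∘ₗ Submodule.subtype _) fun x => by
      have h1 := (LinearMap.mem_graph_iff f x.1).1 x.2.1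
      have h2 := (LinearMap.mem_graph_iff g x.1).1 x.2.2
      simp [← h1, ← h2]
  refine LinearMap.finrank_le_finrank_of_injective (f := p) fun x y h => ?_
  have h1 : x.1.1 = y.1.1 := congrArg Subtype.val h
  have hx := (LinearMap.mem_graph_iff f x.1).1 x.2.1
  have hy := (LinearMap.mem_graph_iff f y.1).1 y.2.1
  exact Subtype.ext (Prod.ext h1 (by rw [hx, hy, h1]))

/-- A lifted maximum rank distance code. -/
theorem exists_lifted_gabidulin_code [Fintype F] {n ν k : ℕ} (hν : 0 < ν) (hνn : 2 * ν ≤ n)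
    (hk : k ≤ ν) :
    ∃ C : Set (ProjSpace F n), C.ncard = Fintype.card F ^ ((n - ν) * k) ∧
      (∀ U ∈ C, finrank F U = ν) ∧
      ∀ U ∈ C, ∀ W ∈ C, U ≠ W → finrank F ↥(U ⊓ W) < k := by
  obtain ⟨p, hp⟩ := CharP.exists F
  have : Fact p.Prime := ⟨CharP.char_is_prime F p⟩
  have : NeZero (n - ν) := ⟨by omega⟩
  -- Degree n - ν ≥ ν leaves room to embed F^ν in L, and L^k has the required q^((n-ν)k) elements.
  let L := FiniteField.Extension F p (n - ν)
  have hL : finrank F L = n - ν := FiniteField.finrank_extension F p (n - ν)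
  obtain ⟨ι, hι⟩ : ∃ ι : (Fin ν → F) →ₗ[F] L, Function.Injective ι := by
    let b := Module.finBasisOfFinrankEq F L hL
    refine ⟨Fintype.linearCombination F fun i : Fin ν => b (Fin.castLE (by omega) i), ?_⟩
    exact linearIndependent_iff_injective_fintypeLinearCombination.1
      (b.linearIndependent.comp _ (Fin.castLE_injective _))
  let e : ((Fin ν → F) × L) ≃ₗ[F] (Fin n → F) := LinearEquiv.ofFinrankEq _ _ (by
    rw [Module.finrank_prod, Module.finrank_fin_fun, Module.finrank_fin_fun, hL]; omega)
  let U : (Fin k → L) → ProjSpace F n := fun a =>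
    (gabidulinMap ι a).graph.map (e : ((Fin ν → F) × L) →ₗ[F] (Fin n → F))
  have hU : ∀ a, finrank F (U a) = ν := fun a => by
    rw [LinearEquiv.finrank_map_eq, finrank_graph, Module.finrank_fin_fun]
  have hUU : ∀ a b, a ≠ b → finrank F ↥(U a ⊓ U b) < k := by
    intro a b hab
    simp only [U]
    rw [← Submodule.map_inf _ e.injective, LinearEquiv.finrank_map_eq]
    refine (finrank_graph_inf_graph_le _ _).trans_lt ?_
    rw [gabidulinMap_sub]
    exact finrank_ker_gabidulinMap_lt hι (sub_ne_zero.2 hab)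
  have hinj : Function.Injective U := by
    intro a b h
    by_contra hab
    have := hUU a b hab
    rw [h, inf_idem, hU] at this
    omega
  refine ⟨Set.range U, ?_, ?_, ?_⟩
  · rw [← Set.image_univ, Set.ncard_image_of_injective _ hinj, Set.ncard_univ, Nat.card_fun,
      FiniteField.natCard_extension, Nat.card_eq_fintype_card, Nat.card_eq_fintype_card,
      Fintype.card_fin, pow_mul]
  · rintro _ ⟨a, rfl⟩
    exact hU a
  · rintro _ ⟨a, rfl⟩ _ ⟨b, rfl⟩ hne
    exact hUU a b fun h => hne (congrArg U h)

/-! ### Both metrics in terms of natural-number dimensions. -/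

section Distances

variable {n : ℕ}

theorem dimR_sup_add_dimR_inf (U V : ProjSpace F n) :
    dimR (U ⊔ V) + dimR (U ⊓ V) = dimR U + dimR V := by
  unfold dimR
  exact_mod_cast Submodule.finrank_sup_add_finrank_inf_eq U V

theorem le_subspaceDist_iff (U V : ProjSpace F n) (d : ℕ) :
    (d : ℝ) ≤ subspaceDist U V ↔
      d + 2 * finrank F ↥(U ⊓ V) ≤ finrank F U + finrank F V := by
  have h := dimR_sup_add_dimR_inf U V
  rw [← Nat.cast_le (α := ℝ)]
  unfold subspaceDist
  unfold dimR at h ⊢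
  push_cast
  constructor <;> intro <;> linarith

theorem le_injectionDist_iff (U V : ProjSpace F n) (d : ℕ) :
    (d : ℝ) ≤ injectionDist U V ↔
      d + finrank F ↥(U ⊓ V) ≤ max (finrank F U) (finrank F V) := by
  have h := dimR_sup_add_dimR_inf U V
  rw [← Nat.cast_le (α := ℝ)]
  unfold injectionDist subspaceDist
  unfold dimR at h ⊢
  push_cast
  rcases le_total (finrank F U : ℝ) (finrank F V) with hle | hle
  · rw [max_eq_right hle, abs_of_nonpos (sub_nonpos.2 hle)]
    constructor <;> intro <;> linarith
  · rw [max_eq_left hle, abs_of_nonneg (sub_nonneg.2 hle)]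
    constructor <;> intro <;> linarith

end Distances

/-! ### Comparison of the maximal cardinalities. -/

theorem maxCard_le_maxCard [Fintype F] {n d d' : ℕ}
    {dist dist' : ProjSpace F n → ProjSpace F n → ℝ}
    (h : ∀ U V, (d : ℝ) ≤ dist U V → (d' : ℝ) ≤ dist' U V) :
    maxCard dist d ≤ maxCard dist' d' := by
  obtain ⟨C, hC, hcard⟩ := (maxCard_isGreatest dist d).1
  exact (maxCard_isGreatest dist' d').2
    ⟨C, ⟨hC.1, fun U hU V hV hne => h U V (hC.2 U hU V hV hne)⟩, hcard⟩

theorem pow_le_AS [Fintype F] {n d : ℕ} (hd : 1 ≤ d) (hdn : d ≤ n / 2) :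
    Fintype.card F ^ ((n - n / 2) * (n / 2 - d + 1)) ≤ AS F n (2 * d) := by
  obtain ⟨C, hcard, hdim, hC⟩ := exists_lifted_gabidulin_code (F := F) (n := n) (ν := n / 2)
    (k := n / 2 - d + 1) (by omega) (by omega) (by omega)
  refine (maxCard_isGreatest subspaceDist (2 * d)).2 ⟨C, ⟨?_, fun U hU V hV hne => ?_⟩, hcard⟩
  · refine Set.nonempty_of_ncard_ne_zero ?_
    rw [hcard]
    exact pow_ne_zero _ Fintype.card_ne_zero
  · rw [le_subspaceDist_iff, hdim U hU, hdim V hV]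
    have := hC U hU V hV hne
    omega

theorem AI_lt [Fintype F] {n d : ℕ} (hd : 1 ≤ d) (hdn : d ≤ n / 2) :
    (AI F n d : ℝ) < 2 * (Kq (Fintype.card F))⁻¹ * theta (Fintype.card F) *
      (Fintype.card F : ℝ) ^ ((n - n / 2) * (n / 2 - d + 1)) := by
  classical
  obtain ⟨C, ⟨-, hC⟩, hcard⟩ := (maxCard_isGreatest (F := F) (n := n) injectionDist d).1
  have hfin : C.Finite := Set.toFinite C
  have hdist : ∀ U ∈ hfin.toFinset, ∀ W ∈ hfin.toFinset, U ≠ W →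
      d + finrank F ↥(U ⊓ W) ≤ max (finrank F U) (finrank F W) := fun U hU W hW hne =>
    (le_injectionDist_iff U W d).1 (hC U (hfin.mem_toFinset.1 hU) W (hfin.mem_toFinset.1 hW) hne)
  have hn : finrank F (Fin n → F) = n := Module.finrank_fin_fun F
  have hlow := card_lt_of_finrank_le (hfin.toFinset.filter fun U => finrank F U ≤ n / 2) hd hdn
    (by omega) (fun U hU => (Finset.mem_filter.1 hU).2) fun U hU W hW =>
      hdist U (Finset.mem_filter.1 hU).1 W (Finset.mem_filter.1 hW).1
  have hhigh := card_lt_of_le_finrank (hfin.toFinset.filter fun U => ¬ finrank F U ≤ n / 2) hd hdn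
    (by omega) (fun U hU => by have := (Finset.mem_filter.1 hU).2; omega) fun U hU W hW =>
      hdist U (Finset.mem_filter.1 hU).1 W (Finset.mem_filter.1 hW).1
  have hsum := Finset.card_filter_add_card_filter_not (s := hfin.toFinset)
    fun U => finrank F U ≤ n / 2
  rw [AI, ← hcard, Set.ncard_eq_toFinset_card C hfin, ← hsum, Nat.cast_add]
  rw [hn] at hlow hhigh
  linarith

theorem AS_two_mul_le (F : Type*) [Field F] [Fintype F] (n d : ℕ) :
    AS F n (2 * d) ≤ AS F n (2 * d - 1) :=
  maxCard_le_maxCard fun _ _ h => le_trans (by exact_mod_cast Nat.sub_le _ _) h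

/-- Since d_S ≤ 2 d_I and 2 d_I is an even integer, d_S ≥ 2d - 1 forces d_I ≥ d. -/
theorem AS_le_AI (F : Type*) [Field F] [Fintype F] (n d : ℕ) :
    AS F n (2 * d - 1) ≤ AI F n d := by
  refine maxCard_le_maxCard fun U V h => ?_
  rw [le_subspaceDist_iff] at h
  rw [le_injectionDist_iff]
  omega

end SubspaceCodes

theorem mainTheorem9 {F : Type*} [Field F] [Fintype F] (q : ℕ) (hq : Fintype.card F = q)
    (n d : ℕ) (hd : 2 ≤ d) (hdn : d ≤ n / 2) :
    (SubspaceCodes.AS F n (2 * d) ≤ SubspaceCodes.AS F n (2 * d - 1) ∧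
      SubspaceCodes.AS F n (2 * d - 1) ≤ SubspaceCodes.AI F n d ∧
      (SubspaceCodes.AI F n d : ℝ) <
        2 * (SubspaceCodes.Kq q)⁻¹ * SubspaceCodes.theta q *
          (SubspaceCodes.AS F n (2 * d) : ℝ)) ∧
    (SubspaceCodes.AI F n d : ℝ) <
      2 * (SubspaceCodes.Kq q) ^ (-2 : ℤ) * SubspaceCodes.theta q *
        (q : ℝ) ^ ((n - n / 2) * (n / 2 - d + 1)) := by
  subst hq
  have hq : 2 ≤ Fintype.card F := Fintype.one_lt_card
  have hK := SubspaceCodes.Kq_pos hq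
  have hθ : 0 ≤ SubspaceCodes.theta (Fintype.card F) := tsum_nonneg fun _ => by positivity
  have hAI := SubspaceCodes.AI_lt (F := F) (by omega : 1 ≤ d) hdn
  refine ⟨⟨SubspaceCodes.AS_two_mul_le F n d, SubspaceCodes.AS_le_AI F n d,
    hAI.trans_le ?_⟩, hAI.trans_le ?_⟩
  · refine mul_le_mul_of_nonneg_left ?_ (by positivity)
    exact_mod_cast SubspaceCodes.pow_le_AS (F := F) (by omega : 1 ≤ d) hdn
  -- As K_q ≤ 1, the bound already obtained with K_q⁻¹ implies the one with K_q⁻².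
  · have hinv : (SubspaceCodes.Kq (Fintype.card F))⁻¹ ≤
        SubspaceCodes.Kq (Fintype.card F) ^ (-2 : ℤ) := by
      rw [zpow_neg, ← inv_zpow]
      exact le_self_pow₀ ((one_le_inv₀ hK).2 (SubspaceCodes.Kq_le_one hq)) two_ne_zero
    gcongr
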